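/- For $R>0$ let $B_R=\{x\in\mathbb R^n : |x|<R\}$, and write $t_+=\max(t,0)$, $t_-=\max(-t,0)$. Let $n\ge 1$ and $\sigma\in(0,1)$. (i) There is a constant $C_1>0$ depending only on $n,\sigma$ such that the following holds. Let $f:(0,\infty)\to\mathbb R$ be $C^1$ with $f'$ locally Hölder continuous on $(0,\infty)$, and let $u$ be a positive classical solution of $-\Delta u=f(u)$ in $\overline B_1$, i.e. $u\in C^2(B_1)\cap C(\overline B_1)$, $u>0$ on $\overline B_1$, and the equation holds pointwise in $B_1$. Then $$\sup_{B_\sigma}\frac{|\nabla u|}{u}\le C_1\Bigl\{1+\sup_{B_1}\sqrt{[f'(u)]_+ +\frac{f_-(u)}{u}}\Bigr\}.$$ (ii) For every real $p>1$ there is a constant $C_2>0$ depending only on $n,\sigma,p$ such that every positive classical solution $u$ (in the same sense) of $-\Delta u=u^p$ in $\overline B_1$ satisfies $$\sup_{B_\sigma}\frac{|\nabla u|}{u}\le C_2\Bigl(1+\sup_{B_1}u\Bigr)^{\frac{p-1}{2}}.$$ -/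

import Mathlib

open Set Metric InnerProductSpace
open scoped NNReal ENNReal Topology Gradient

/-- `g` is locally Hölder continuous on `S`: every point of `S` has a neighbourhood in `S` on which
`g` is Hölder continuous with some exponent `α ∈ (0, 1]`. The exponent and the constant
may depend on the point. -/
def LocallyHolderOn (g : ℝ → ℝ) (S : Set ℝ) : Prop :=
  ∀ s ∈ S, ∃ α : ℝ≥0, 0 < α ∧ α ≤ 1 ∧ ∃ K : ℝ≥0, ∃ V ∈ 𝓝[S] s, HolderOnWith K α g V

/-- `u` is a positive classical solution of `-Δ u = f(u)` in the closed unit ball of `ℝⁿ`: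
`u` is continuous and positive on the closed ball, is `C²` in the open ball and solves the equation
there pointwise. (No regularity of the derivatives of `u` up to the boundary is required, so that
solutions that are `C²` up to the boundary are included.) Only the values of `f` on `(0, ∞)` and
of `u` on the closed ball matter. -/
structure IsPositiveClassicalSolution {n : ℕ} (f : ℝ → ℝ)
    (u : EuclideanSpace ℝ (Fin n) → ℝ) : Prop where
  continuousOn : ContinuousOn u (closedBall 0 1)
  contDiffOn : ContDiffOn ℝ 2 u (ball 0 1)
  pos : ∀ x ∈ closedBall (0 : EuclideanSpace ℝ (Fin n)) 1, 0 < u x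
  equation : ∀ x ∈ ball (0 : EuclideanSpace ℝ (Fin n)) 1, -(Laplacian.laplacian u x) = f (u x)

/-- The supremum over the open ball `B_R` of a nonnegative function `g`, as an extended nonnegative
number. -/
noncomputable def supBall {n : ℕ} (R : ℝ) (g : EuclideanSpace ℝ (Fin n) → ℝ) : ℝ≥0∞ :=
  ⨆ x ∈ ball (0 : EuclideanSpace ℝ (Fin n)) R, ENNReal.ofReal (g x)

/-!
The proof is Bernstein's technique applied to `v = log u`. With `h = f(u) / u` the equation becomes
`-Δv = |∇v|² + h`, and differentiating `h` gives `∇v · ∇h = (f'(u) - f(u) / u) |∇v|²`. If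
`M² = sup ([f'(u)]₊ + f₋(u) / u)`, then `h ≥ -M²` and `∇v · ∇h ≤ M² |∇v|²`. Bochner's identity for
`w = |∇v|²` (`lapl_gradSq`) and the trace inequality `|D²v|² ≥ (Δv)² / n` (`sq_lapl_le`) turn this
into
`½ Δw + ∇v · ∇w ≥ (w + h)² / n - M² w`,
whose right-hand side is comparable to `w²` when `w` is large compared with `M²`. Evaluated at an
interior maximum of `(r² - |x|²)² w` (`conditions_of_isLocalMax`), it bounds this maximum by a
multiple of `1 + M²` (`bernstein_estimate`).

This computation uses three derivatives of `v`, whereas `u` is only `C²`. Elliptic regularity, and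
with it the Hölder continuity of `f'`, is avoided by mollifying `v`: since `Δv = -|∇v|² - h` is of
class `C¹`, the mollified functions converge together with their derivatives up to order two and the
gradients of their Laplacians (`exists_smooth_approximation`), and no other derivative occurs in the
two hypotheses of `bernstein_estimate`. These hypotheses therefore hold for the approximations with
a slightly larger constant, and the resulting gradient bound passes to the limit
(`bernstein_estimate_of_contDiffOn`).

The second part is the case `f(s) = s ^ p`, in which `[f'(u)]₊ + f₋(u) / u = p u ^ (p - 1)`.
-/

/-! ### Partial derivatives and the second derivative test -/

/-- The partial derivative `∂ᵢ φ` of a function on `ℝⁿ`; it is `0` where `φ` is not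
differentiable. -/
noncomputable def partialDeriv {n : ℕ} (i : Fin n) (φ : EuclideanSpace ℝ (Fin n) → ℝ)
    (x : EuclideanSpace ℝ (Fin n)) : ℝ :=
  fderiv ℝ φ x (EuclideanSpace.single i 1)

section PartialDeriv

variable {n : ℕ} {φ ψ : EuclideanSpace ℝ (Fin n) → ℝ} {x : EuclideanSpace ℝ (Fin n)}

lemma partialDeriv_congr (i : Fin n) (h : φ =ᶠ[𝓝 x] ψ) :
    partialDeriv i φ x = partialDeriv i ψ x := by
  simp only [partialDeriv, h.fderiv_eq]

lemma ContDiffAt.partialDeriv (i : Fin n) {m k : WithTop ℕ∞} (h : ContDiffAt ℝ k φ x)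
    (hmk : m + 1 ≤ k) : ContDiffAt ℝ m (partialDeriv i φ) x :=
  (h.fderiv_right hmk).clm_apply contDiffAt_const

lemma ContDiff.partialDeriv (i : Fin n) {m k : WithTop ℕ∞} (h : ContDiff ℝ k φ)
    (hmk : m + 1 ≤ k) : ContDiff ℝ m (partialDeriv i φ) :=
  contDiff_iff_contDiffAt.2 fun _ => h.contDiffAt.partialDeriv i hmk

lemma HasCompactSupport.partialDeriv (i : Fin n) (h : HasCompactSupport φ) :
    HasCompactSupport (partialDeriv i φ) :=
  h.fderiv_apply (𝕜 := ℝ) _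

lemma partialDeriv_add (i : Fin n) (hφ : DifferentiableAt ℝ φ x) (hψ : DifferentiableAt ℝ ψ x) :
    partialDeriv i (fun y => φ y + ψ y) x = partialDeriv i φ x + partialDeriv i ψ x := by
  simp [partialDeriv, fderiv_fun_add hφ hψ]

lemma partialDeriv_sub (i : Fin n) (hφ : DifferentiableAt ℝ φ x) (hψ : DifferentiableAt ℝ ψ x) :
    partialDeriv i (fun y => φ y - ψ y) x = partialDeriv i φ x - partialDeriv i ψ x := by
  simp [partialDeriv, fderiv_fun_sub hφ hψ]

lemma partialDeriv_neg (i : Fin n) :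
    partialDeriv i (fun y => -φ y) x = -partialDeriv i φ x := by
  simp [partialDeriv, fderiv_fun_neg]

lemma partialDeriv_sum (i : Fin n) {ι : Type*} (s : Finset ι)
    {F : ι → EuclideanSpace ℝ (Fin n) → ℝ} (hF : ∀ j ∈ s, DifferentiableAt ℝ (F j) x) :
    partialDeriv i (fun y => ∑ j ∈ s, F j y) x = ∑ j ∈ s, partialDeriv i (F j) x := by
  simp [partialDeriv, fderiv_fun_sum hF]

lemma partialDeriv_mul (i : Fin n) (hφ : DifferentiableAt ℝ φ x) (hψ : DifferentiableAt ℝ ψ x) :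
    partialDeriv i (fun y => φ y * ψ y) x
      = partialDeriv i φ x * ψ x + φ x * partialDeriv i ψ x := by
  simp [partialDeriv, fderiv_fun_mul hφ hψ]; ring

lemma partialDeriv_sq (i : Fin n) (hφ : DifferentiableAt ℝ φ x) :
    partialDeriv i (fun y => φ y ^ 2) x = 2 * φ x * partialDeriv i φ x := by
  simp only [sq]; rw [partialDeriv_mul i hφ hφ]; ring

/-- The chain rule for the composition with a function of one variable. -/
lemma partialDeriv_comp (i : Fin n) {g : ℝ → ℝ} (hg : DifferentiableAt ℝ g (φ x))
    (hφ : DifferentiableAt ℝ φ x) :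
    partialDeriv i (fun y => g (φ y)) x = deriv g (φ x) * partialDeriv i φ x := by
  have h := (hg.hasDerivAt.comp_hasFDerivAt x hφ.hasFDerivAt).fderiv
  simp only [Function.comp_def] at h
  simp [partialDeriv, h]

lemma partialDeriv_comm (i j : Fin n) (h : ContDiffAt ℝ 2 φ x) :
    partialDeriv i (partialDeriv j φ) x = partialDeriv j (partialDeriv i φ) x := by
  have hd : DifferentiableAt ℝ (fderiv ℝ φ) x :=
    (h.fderiv_right (m := 1) (by norm_num)).differentiableAt (by norm_num)
  have key : ∀ a b : Fin n, partialDeriv a (partialDeriv b φ) x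
      = fderiv ℝ (fderiv ℝ φ) x (EuclideanSpace.single a 1) (EuclideanSpace.single b 1) := by
    intro a b
    have := (hd.hasFDerivAt.clm_apply
      (hasFDerivAt_const (EuclideanSpace.single b (1 : ℝ)) x)).fderiv
    simp only [partialDeriv]
    change fderiv ℝ (fun y => fderiv ℝ φ y (EuclideanSpace.single b 1)) x _ = _
    rw [this]; simp
  rw [key, key]
  exact (h.isSymmSndFDerivAt (by simp)) _ _

lemma partialDeriv_partialDeriv_mul (i : Fin n) (hφ : ContDiffAt ℝ 2 φ x)
    (hψ : ContDiffAt ℝ 2 ψ x) :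
    partialDeriv i (partialDeriv i (fun y => φ y * ψ y)) x
      = partialDeriv i (partialDeriv i φ) x * ψ x
        + 2 * (partialDeriv i φ x * partialDeriv i ψ x)
        + φ x * partialDeriv i (partialDeriv i ψ) x := by
  have h : partialDeriv i (fun y => φ y * ψ y) =ᶠ[𝓝 x]
      fun y => partialDeriv i φ y * ψ y + φ y * partialDeriv i ψ y := by
    filter_upwards [hφ.eventually (by simp), hψ.eventually (by simp)] with y h1 h2
    exact partialDeriv_mul i (h1.differentiableAt (by norm_num)) (h2.differentiableAt (by norm_num))
  have d1 := hφ.differentiableAt (by norm_num)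
  have d2 := hψ.differentiableAt (by norm_num)
  have d3 := (hφ.partialDeriv i (m := 1) (by norm_num)).differentiableAt (by norm_num)
  have d4 := (hψ.partialDeriv i (m := 1) (by norm_num)).differentiableAt (by norm_num)
  rw [partialDeriv_congr i h, partialDeriv_add i (d3.fun_mul d2) (d1.fun_mul d4),
    partialDeriv_mul i d3 d2, partialDeriv_mul i d1 d4]
  ring

lemma laplacian_eq_sum_partialDeriv (h : ContDiffAt ℝ 2 φ x) :
    Laplacian.laplacian φ x = ∑ i, partialDeriv i (partialDeriv i φ) x := by
  have hd : DifferentiableAt ℝ (fderiv ℝ φ) x :=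
    (h.fderiv_right (m := 1) (by norm_num)).differentiableAt (by norm_num)
  rw [laplacian_eq_iteratedFDeriv_orthonormalBasis φ (EuclideanSpace.basisFun (Fin n) ℝ)]
  refine Finset.sum_congr rfl fun i _ => ?_
  have := (hd.hasFDerivAt.clm_apply
      (hasFDerivAt_const (EuclideanSpace.single i (1 : ℝ)) x)).fderiv
  simp only [partialDeriv]
  change _ = fderiv ℝ (fun y => fderiv ℝ φ y (EuclideanSpace.single i 1)) x _
  rw [this]
  simp [iteratedFDeriv_two_apply]

lemma norm_gradient_sq (φ : EuclideanSpace ℝ (Fin n) → ℝ) (x : EuclideanSpace ℝ (Fin n)) :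
    ‖∇ φ x‖ ^ 2 = ∑ i, partialDeriv i φ x ^ 2 := by
  rw [EuclideanSpace.norm_sq_eq]
  refine Finset.sum_congr rfl fun i _ => ?_
  have : (∇ φ x) i = partialDeriv i φ x := by
    rw [partialDeriv, ← inner_gradient_left, EuclideanSpace.inner_single_right]
    simp
  rw [this, Real.norm_eq_abs, sq_abs]

lemma IsLocalMax.partialDeriv_eq_zero (i : Fin n) (h : IsLocalMax φ x) :
    partialDeriv i φ x = 0 := by
  simp [partialDeriv, h.fderiv_eq_zero]

/-- The second derivative test: at a local maximum the pure second derivatives are nonpositive. -/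
lemma IsLocalMax.partialDeriv_partialDeriv_nonpos (i : Fin n) (h : IsLocalMax φ x)
    (hφ : ContDiffAt ℝ 2 φ x) : partialDeriv i (partialDeriv i φ) x ≤ 0 := by
  by_contra! hpos
  set e : EuclideanSpace ℝ (Fin n) := EuclideanSpace.single i 1
  have hl : ∀ t : ℝ, HasDerivAt (fun t : ℝ => x + t • e) e t := fun t => by
    simpa using ((hasDerivAt_id t).smul_const e).const_add x
  have hl0 : x + (0 : ℝ) • e = x := by simp
  have hlc : Filter.Tendsto (fun t : ℝ => x + t • e) (𝓝 0) (𝓝 x) := by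
    simpa [hl0] using (hl 0).continuousAt.tendsto
  set g : ℝ → ℝ := fun t => φ (x + t • e)
  have hg : deriv g =ᶠ[𝓝 0] fun t => partialDeriv i φ (x + t • e) := by
    filter_upwards [hlc.eventually (hφ.eventually (by simp))] with t ht
    exact ((ht.differentiableAt (by norm_num)).hasFDerivAt.comp_hasDerivAt t (hl t)).deriv
  have d := (hφ.partialDeriv i (m := 1) (by norm_num)).differentiableAt (by norm_num)
  have hgg : deriv (deriv g) 0 = partialDeriv i (partialDeriv i φ) x := by
    rw [hg.deriv_eq]
    have d' : HasFDerivAt (partialDeriv i φ) (fderiv ℝ (partialDeriv i φ) x) (x + (0 : ℝ) • e) := by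
      rw [hl0]; exact d.hasFDerivAt
    exact (d'.comp_hasDerivAt 0 (hl 0)).deriv
  have hg0 : deriv g 0 = 0 := by
    rw [hg.eq_of_nhds, hl0, h.partialDeriv_eq_zero]
  have hmax : IsLocalMax g 0 := by
    have := hlc.eventually h
    simpa [IsLocalMax, IsMaxFilter, g] using this
  have hmin : IsLocalMin g 0 := by
    refine isLocalMin_of_deriv_deriv_pos (by rw [hgg]; exact hpos) hg0 ?_
    have h1 : ContinuousAt φ (x + (0 : ℝ) • e) := by rw [hl0]; exact hφ.continuousAt
    exact ContinuousAt.comp (f := fun t : ℝ => x + t • e) h1 (hl 0).continuousAt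
  -- a point that is both a local maximum and a local minimum: `g` is constant near it
  have hconst : g =ᶠ[𝓝 0] fun _ => g 0 := by
    filter_upwards [hmax, hmin] with t h1 h2 using le_antisymm h1 h2
  have : deriv (deriv g) 0 = 0 := by
    rw [hconst.deriv.deriv_eq]; simp
  linarith

end PartialDeriv

/-! ### The Bernstein estimate for smooth functions -/

section Bernstein

variable {n : ℕ} {v : EuclideanSpace ℝ (Fin n) → ℝ} {x : EuclideanSpace ℝ (Fin n)}

/-- The squared length `|∇φ|²` of the gradient, in coordinates. -/
noncomputable def gradSq (φ : EuclideanSpace ℝ (Fin n) → ℝ) (x : EuclideanSpace ℝ (Fin n)) : ℝ :=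
  ∑ j, partialDeriv j φ x ^ 2

/-- The Laplacian in coordinates, as the sum of the pure second partial derivatives. -/
noncomputable def lapl (φ : EuclideanSpace ℝ (Fin n) → ℝ) (x : EuclideanSpace ℝ (Fin n)) : ℝ :=
  ∑ i, partialDeriv i (partialDeriv i φ) x

lemma gradSq_nonneg (φ : EuclideanSpace ℝ (Fin n) → ℝ) (x : EuclideanSpace ℝ (Fin n)) :
    0 ≤ gradSq φ x :=
  Finset.sum_nonneg fun _ _ => sq_nonneg _

lemma ContDiffAt.gradSq {m k : WithTop ℕ∞} (h : ContDiffAt ℝ k v x) (hmk : m + 1 ≤ k) :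
    ContDiffAt ℝ m (gradSq v) x :=
  ContDiffAt.sum fun j _ => (h.partialDeriv j hmk).pow 2

lemma ContDiff.gradSq {m k : WithTop ℕ∞} (h : ContDiff ℝ k v) (hmk : m + 1 ≤ k) :
    ContDiff ℝ m (gradSq v) :=
  contDiff_iff_contDiffAt.2 fun _ => h.contDiffAt.gradSq hmk

lemma partialDeriv_gradSq (i : Fin n) (h : ContDiffAt ℝ 2 v x) :
    partialDeriv i (gradSq v) x
      = ∑ j, 2 * partialDeriv j v x * partialDeriv i (partialDeriv j v) x := by
  have d : ∀ j, DifferentiableAt ℝ (partialDeriv j v) x := fun j =>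
    (h.partialDeriv j (m := 1) (by norm_num)).differentiableAt (by norm_num)
  change partialDeriv i (fun y => ∑ j, partialDeriv j v y ^ 2) x = _
  rw [partialDeriv_sum i _ fun j _ => (d j).fun_pow 2]
  exact Finset.sum_congr rfl fun j _ => partialDeriv_sq i (d j)

/-- Bochner's identity `½ Δ|∇v|² = |D²v|² + ∇v · ∇Δv`. -/
lemma lapl_gradSq (h : ContDiff ℝ 3 v) :
    lapl (gradSq v) x = 2 * ∑ i, ∑ j, partialDeriv i (partialDeriv j v) x ^ 2
      + 2 * ∑ j, partialDeriv j v x * partialDeriv j (lapl v) x := by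
  have c1 : ∀ j, ContDiff ℝ 2 (partialDeriv j v) := fun j => h.partialDeriv j (by norm_num)
  have c2 : ∀ i j, ContDiff ℝ 1 (partialDeriv i (partialDeriv j v)) := fun i j =>
    (c1 j).partialDeriv i (by norm_num)
  have d2 : ∀ i j y, DifferentiableAt ℝ (partialDeriv i (partialDeriv j v)) y := fun i j y =>
    (c2 i j).contDiffAt.differentiableAt (by norm_num)
  have cs : ∀ j, ContDiff ℝ 2 (fun y => partialDeriv j v y * partialDeriv j v y) := fun j =>
    (c1 j).mul (c1 j)
  have third : ∀ i j, partialDeriv i (partialDeriv i (partialDeriv j v)) x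
      = partialDeriv j (partialDeriv i (partialDeriv i v)) x := by
    intro i j
    have : partialDeriv i (partialDeriv j v) = partialDeriv j (partialDeriv i v) :=
      funext fun y => partialDeriv_comm i j (h.contDiffAt.of_le (by norm_num))
    rw [this, partialDeriv_comm i j (c1 i).contDiffAt]
  have e1 : ∀ i, partialDeriv i (partialDeriv i (gradSq v)) x
      = ∑ j, (2 * partialDeriv i (partialDeriv j v) x ^ 2
          + 2 * (partialDeriv j v x * partialDeriv j (partialDeriv i (partialDeriv i v)) x)) := by
    intro i
    have : partialDeriv i (gradSq v)
        = fun y => ∑ j, partialDeriv i (fun z => partialDeriv j v z * partialDeriv j v z) y := by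
      funext y
      rw [← partialDeriv_sum i _ fun j _ => (cs j).contDiffAt.differentiableAt (by norm_num)]
      simp only [← sq]; rfl
    rw [this, partialDeriv_sum i _ fun j _ =>
      ((cs j).partialDeriv i (m := 1) (by norm_num)).contDiffAt.differentiableAt (by norm_num)]
    refine Finset.sum_congr rfl fun j _ => ?_
    rw [partialDeriv_partialDeriv_mul i (c1 j).contDiffAt (c1 j).contDiffAt, third]
    ring
  have e2 : ∀ j, partialDeriv j (lapl v) x
      = ∑ i, partialDeriv j (partialDeriv i (partialDeriv i v)) x := fun j =>
    partialDeriv_sum j _ fun i _ => d2 i i x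
  simp only [lapl, e1]
  simp only [e2, Finset.sum_add_distrib, Finset.mul_sum]
  congr 1
  exact Finset.sum_comm

/-- The trace inequality `(Δv)² ≤ n |D²v|²`. -/
lemma sq_lapl_le (v : EuclideanSpace ℝ (Fin n) → ℝ) (x : EuclideanSpace ℝ (Fin n)) :
    lapl v x ^ 2 ≤ n * ∑ i, ∑ j, partialDeriv i (partialDeriv j v) x ^ 2 := by
  have h1 : lapl v x ^ 2 ≤ n * ∑ i, partialDeriv i (partialDeriv i v) x ^ 2 := by
    simpa [lapl] using sq_sum_le_card_mul_sum_sq (s := Finset.univ)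
      (f := fun i => partialDeriv i (partialDeriv i v) x)
  refine h1.trans (mul_le_mul_of_nonneg_left ?_ n.cast_nonneg)
  refine Finset.sum_le_sum fun i _ => ?_
  exact Finset.single_le_sum (f := fun j => partialDeriv i (partialDeriv j v) x ^ 2)
    (fun j _ => sq_nonneg _) (Finset.mem_univ i)

lemma contDiff_const_sub_norm_sq (c : ℝ) {m : WithTop ℕ∞} :
    ContDiff ℝ m (fun y : EuclideanSpace ℝ (Fin n) => c - ‖y‖ ^ 2) :=
  contDiff_const.sub (contDiff_norm_sq ℝ)

lemma partialDeriv_const_sub_norm_sq (i : Fin n) (c : ℝ) :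
    partialDeriv i (fun y : EuclideanSpace ℝ (Fin n) => c - ‖y‖ ^ 2) = fun y => -2 * y i := by
  funext y
  have h : HasFDerivAt (fun y : EuclideanSpace ℝ (Fin n) => ‖y‖ ^ 2) (2 • innerSL ℝ y) y :=
    (hasStrictFDerivAt_norm_sq y).hasFDerivAt
  rw [partialDeriv, (h.const_sub c).fderiv]
  simp [EuclideanSpace.inner_single_right]

lemma partialDeriv_partialDeriv_const_sub_norm_sq (i : Fin n) (c : ℝ)
    (x : EuclideanSpace ℝ (Fin n)) :
    partialDeriv i (partialDeriv i (fun y : EuclideanSpace ℝ (Fin n) => c - ‖y‖ ^ 2)) x = -2 := by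
  rw [partialDeriv_const_sub_norm_sq]
  have h : HasFDerivAt (fun y : EuclideanSpace ℝ (Fin n) => y i)
      (EuclideanSpace.proj i : EuclideanSpace ℝ (Fin n) →L[ℝ] ℝ) x :=
    (EuclideanSpace.proj (𝕜 := ℝ) i).hasFDerivAt
  rw [partialDeriv, (h.const_mul (-2)).fderiv]
  simp

/-- The two conditions at an interior maximum of `ζ² w` with `ζ = c - |x|² > 0`: the first
derivatives give `ζ ∂ᵢw = 4 xᵢ w`, and the Laplacian, once the cross terms are eliminated with
these, bounds `ζ² Δw`. -/
lemma conditions_of_isLocalMax {c : ℝ} {w : EuclideanSpace ℝ (Fin n) → ℝ} (hw : ContDiffAt ℝ 2 w x)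
    (hζ : 0 < c - ‖x‖ ^ 2) (hmax : IsLocalMax (fun y => (c - ‖y‖ ^ 2) ^ 2 * w y) x) :
    (∀ i, (c - ‖x‖ ^ 2) * partialDeriv i w x = 4 * x i * w x) ∧
      (c - ‖x‖ ^ 2) ^ 2 * lapl w x ≤ (24 * ‖x‖ ^ 2 + 4 * n * (c - ‖x‖ ^ 2)) * w x := by
  set ζ : EuclideanSpace ℝ (Fin n) → ℝ := fun y => c - ‖y‖ ^ 2 with hζdef
  have cζ : ContDiff ℝ 2 ζ := contDiff_const_sub_norm_sq c
  have cη : ContDiff ℝ 2 (fun y => ζ y * ζ y) := cζ.mul cζ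
  have hη : (fun y => (c - ‖y‖ ^ 2) ^ 2 * w y) = fun y => (ζ y * ζ y) * w y := by
    funext y; simp only [ζ]; ring
  rw [hη] at hmax
  have dζ : DifferentiableAt ℝ ζ x := cζ.contDiffAt.differentiableAt (by norm_num)
  have dη : DifferentiableAt ℝ (fun y => ζ y * ζ y) x := dζ.fun_mul dζ
  have dw : DifferentiableAt ℝ w x := hw.differentiableAt (by norm_num)
  have p1 : ∀ i, partialDeriv i ζ x = -2 * x i := fun i =>
    congrFun (partialDeriv_const_sub_norm_sq i c) x
  have first : ∀ i, ζ x * partialDeriv i w x = 4 * x i * w x := by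
    intro i
    have h := hmax.partialDeriv_eq_zero i
    rw [partialDeriv_mul i dη dw, partialDeriv_mul i dζ dζ, p1] at h
    have : ζ x * (ζ x * partialDeriv i w x - 4 * x i * w x) = 0 := by linarith
    rcases mul_eq_zero.1 this with h0 | h0
    · exact absurd h0 hζ.ne'
    · linarith
  refine ⟨first, ?_⟩
  have second : ∀ i, ζ x ^ 2 * partialDeriv i (partialDeriv i w) x
      ≤ (24 * x i ^ 2 + 4 * ζ x) * w x := by
    intro i
    have h := hmax.partialDeriv_partialDeriv_nonpos i (cη.contDiffAt.mul hw)
    rw [partialDeriv_partialDeriv_mul i cη.contDiffAt hw,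
      partialDeriv_partialDeriv_mul i cζ.contDiffAt cζ.contDiffAt, partialDeriv_mul i dζ dζ, p1,
      partialDeriv_partialDeriv_const_sub_norm_sq] at h
    have f := first i
    have : x i * (ζ x * partialDeriv i w x) = x i * (4 * x i * w x) := by rw [f]
    nlinarith
  have hx : ‖x‖ ^ 2 = ∑ i, x i ^ 2 := by
    rw [EuclideanSpace.norm_sq_eq]; simp
  calc ζ x ^ 2 * lapl w x = ∑ i, ζ x ^ 2 * partialDeriv i (partialDeriv i w) x := by
        rw [lapl, Finset.mul_sum]
    _ ≤ ∑ i, (24 * x i ^ 2 + 4 * ζ x) * w x := Finset.sum_le_sum fun i _ => second i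
    _ = (24 * ‖x‖ ^ 2 + 4 * n * ζ x) * w x := by
        rw [← Finset.sum_mul, Finset.sum_add_distrib, ← Finset.mul_sum, ← hx]
        simp only [Finset.sum_const, Finset.card_univ, Fintype.card_fin, nsmul_eq_mul]
        ring

/-- The arithmetic behind the estimate: with `w = p²`, the differential inequality at the maximum
is a quadratic inequality for `ζ p`. -/
lemma sq_mul_le_of_quadratic {N A p ζ : ℝ} (hN : 1 ≤ N) (hA : 0 ≤ A)
    (hζ : 0 ≤ ζ) (hζ1 : ζ ≤ 1) (hp1 : 1 ≤ p ^ 2)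
    (h : ζ ^ 2 * (p ^ 2) ^ 2 / (4 * N) ≤
      4 * ζ * p ^ 2 * p + ζ ^ 2 * (A * (p ^ 2 + 1)) + 14 * N * p ^ 2) :
    (ζ * p) ^ 2 ≤ 368 * N ^ 2 * (1 + A) := by
  have hp2 : 0 < p ^ 2 := by linarith
  have hζ2 : ζ ^ 2 ≤ 1 := by nlinarith
  have h1 : ζ ^ 2 * (A * (p ^ 2 + 1)) ≤ 2 * A * p ^ 2 := by
    have : A * (p ^ 2 + 1) ≤ 2 * A * p ^ 2 := by nlinarith
    have h0 : 0 ≤ A * (p ^ 2 + 1) := by positivity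
    nlinarith
  have h2 : (ζ * p) ^ 2 ≤ 4 * N * (4 * (ζ * p) + 2 * A + 14 * N) := by
    have h3 : ζ ^ 2 * (p ^ 2) ^ 2 ≤ 4 * N * (4 * ζ * p ^ 2 * p + 2 * A * p ^ 2 + 14 * N * p ^ 2) := by
      rw [div_le_iff₀ (by linarith)] at h
      nlinarith
    have h4 : p ^ 2 * (ζ * p) ^ 2 ≤ p ^ 2 * (4 * N * (4 * (ζ * p) + 2 * A + 14 * N)) := by
      nlinarith
    exact le_of_mul_le_mul_left h4 hp2
  have h5 : 16 * N * (ζ * p) ≤ (ζ * p) ^ 2 / 2 + 128 * N ^ 2 := by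
    nlinarith [sq_nonneg (ζ * p - 16 * N)]
  nlinarith [mul_nonneg hA (sub_nonneg.2 hN), mul_nonneg hA (sq_nonneg (N - 1))]

/-- **Bernstein's gradient estimate.** Write `w = |∇v|²` and `-Δv = w + h`. If `h ≥ -A` and
`∇v · ∇h ≤ A (w + 1)` in the ball of radius `r ≤ 1`, then `(r² - |x|²)² w` is bounded there by a
multiple of `1 + A`. At a maximum, Bochner's identity together with `|D²v|² ≥ (Δv)² / n` produces
the term `w²`, which dominates all the others. -/
lemma bernstein_estimate {r A : ℝ} (hr0 : 0 < r) (hr1 : r ≤ 1) (hA : 0 ≤ A) (hv : ContDiff ℝ 3 v)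
    (h1 : ∀ y ∈ ball (0 : EuclideanSpace ℝ (Fin n)) r, -A ≤ -lapl v y - gradSq v y)
    (h2 : ∀ y ∈ ball (0 : EuclideanSpace ℝ (Fin n)) r,
      ∑ j, partialDeriv j v y * (-partialDeriv j (lapl v) y - partialDeriv j (gradSq v) y)
        ≤ A * (gradSq v y + 1))
    (hx : x ∈ ball (0 : EuclideanSpace ℝ (Fin n)) r) :
    (r ^ 2 - ‖x‖ ^ 2) ^ 2 * gradSq v x ≤ 368 * ((n : ℝ) + 1) ^ 2 * (1 + A) := by
  set F : EuclideanSpace ℝ (Fin n) → ℝ := fun y => (r ^ 2 - ‖y‖ ^ 2) ^ 2 * gradSq v y with hF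
  have cw : ContDiff ℝ 2 (gradSq v) := hv.gradSq (by norm_num)
  have hFc : Continuous F :=
    ((contDiff_const_sub_norm_sq (m := 0) _).continuous.pow 2).mul cw.continuous
  obtain ⟨y, hy, hmax⟩ := (isCompact_closedBall (0 : EuclideanSpace ℝ (Fin n)) r).exists_isMaxOn
    ⟨x, ball_subset_closedBall hx⟩ hFc.continuousOn
  refine (hmax (ball_subset_closedBall hx)).trans ?_
  have hN : (1 : ℝ) ≤ n + 1 := by linarith [(n.cast_nonneg : (0 : ℝ) ≤ n)]
  have hw0 : 0 ≤ gradSq v y := gradSq_nonneg v y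
  have hyr : ‖y‖ ≤ r := by simpa using hy
  have hbig : 1 + 2 * A ≤ 368 * ((n : ℝ) + 1) ^ 2 * (1 + A) := by
    have h : 1 ≤ ((n : ℝ) + 1) ^ 2 := one_le_pow₀ hN
    have : 1 * (1 + A) ≤ ((n : ℝ) + 1) ^ 2 * (1 + A) := by gcongr
    linarith
  rcases hyr.eq_or_lt with hyr | hyr
  · have : F y = 0 := by simp [hF, hyr]
    rw [this]; positivity
  have hyb : y ∈ ball (0 : EuclideanSpace ℝ (Fin n)) r := by simpa using hyr
  have hζ : 0 < r ^ 2 - ‖y‖ ^ 2 := by nlinarith [norm_nonneg y]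
  have hζ1 : r ^ 2 - ‖y‖ ^ 2 ≤ 1 := by nlinarith [norm_nonneg y]
  rcases le_or_gt (gradSq v y) (1 + 2 * A) with hsmall | hlarge
  · refine le_trans ?_ hbig
    have : (r ^ 2 - ‖y‖ ^ 2) ^ 2 ≤ 1 := by nlinarith
    calc F y ≤ 1 * gradSq v y := mul_le_mul_of_nonneg_right this hw0
      _ ≤ 1 + 2 * A := by linarith
  have hloc : IsLocalMax F y :=
    (hmax.on_subset ball_subset_closedBall).isLocalMax (isOpen_ball.mem_nhds hyb)
  obtain ⟨c1, c2⟩ := conditions_of_isLocalMax cw.contDiffAt hζ hloc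
  have hb := lapl_gradSq (x := y) hv
  have htr := sq_lapl_le v y
  have hh1 := h1 y hyb
  have hh2 := h2 y hyb
  set ζ := r ^ 2 - ‖y‖ ^ 2
  set w := gradSq v y with hw
  set H := ∑ i, ∑ j, partialDeriv i (partialDeriv j v) y ^ 2
  have hH : 0 ≤ H := Finset.sum_nonneg fun i _ => Finset.sum_nonneg fun j _ => sq_nonneg _
  set p := √w
  have hp : p ^ 2 = w := Real.sq_sqrt hw0
  -- the transport term, through Cauchy-Schwarz
  have hcs : |∑ j, partialDeriv j v y * y j| ≤ p := by
    apply Real.abs_le_sqrt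
    have := Finset.sum_mul_sq_le_sq_mul_sq Finset.univ (fun j => partialDeriv j v y) (fun j => y j)
    have hy2 : ∑ i, y i ^ 2 ≤ 1 := by
      have : ‖y‖ ^ 2 = ∑ i, y i ^ 2 := by rw [EuclideanSpace.norm_sq_eq]; simp
      rw [← this]; nlinarith [norm_nonneg y]
    calc _ ≤ w * ∑ i, y i ^ 2 := this
      _ ≤ w := by nlinarith
  have htrans : ζ * ∑ j, partialDeriv j v y * partialDeriv j (gradSq v) y
      = 4 * w * ∑ j, partialDeriv j v y * y j := by
    rw [Finset.mul_sum, Finset.mul_sum]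
    refine Finset.sum_congr rfl fun j _ => ?_
    linear_combination partialDeriv j v y * c1 j
  have hsplit : ∑ j, partialDeriv j v y
        * (-partialDeriv j (lapl v) y - partialDeriv j (gradSq v) y)
      = -(∑ j, partialDeriv j v y * partialDeriv j (lapl v) y)
        - ∑ j, partialDeriv j v y * partialDeriv j (gradSq v) y := by
    rw [← Finset.sum_neg_distrib, ← Finset.sum_sub_distrib]
    exact Finset.sum_congr rfl fun j _ => by ring
  rw [hsplit] at hh2
  set P := ∑ j, partialDeriv j v y * partialDeriv j (lapl v) y
  set Q := ∑ j, partialDeriv j v y * partialDeriv j (gradSq v) y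
  set X := ∑ j, partialDeriv j v y * y j
  have hX : X ≤ p := (abs_le.1 hcs).2
  -- `-Δv ≥ w - A ≥ w / 2` turns the trace inequality into a lower bound for the Hessian
  have hHw : w ^ 2 / (4 * ((n : ℝ) + 1)) ≤ H := by
    rw [div_le_iff₀ (by linarith)]
    have : (w / 2) ^ 2 ≤ lapl v y ^ 2 := by
      rw [← neg_sq (lapl v y)]
      exact pow_le_pow_left₀ (by linarith) (by linarith) 2
    nlinarith
  have hX' : ζ ^ 2 * Q ≤ 4 * ζ * w * p := by
    have : 0 ≤ ζ * w * (p - X) := mul_nonneg (mul_nonneg hζ.le hw0) (sub_nonneg.2 hX)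
    linear_combination 4 * this + ζ * htrans
  have hy1 : ‖y‖ ^ 2 ≤ 1 := by nlinarith [norm_nonneg y]
  have hc2 : ζ ^ 2 * lapl (gradSq v) y ≤ 28 * ((n : ℝ) + 1) * w := by
    refine c2.trans (mul_le_mul_of_nonneg_right ?_ hw0)
    have : (n : ℝ) * ζ ≤ n := mul_le_of_le_one_right n.cast_nonneg hζ1
    nlinarith
  rw [hb] at hc2
  have hfin : ζ ^ 2 * H ≤ 4 * ζ * w * p + ζ ^ 2 * (A * (w + 1)) + 14 * ((n : ℝ) + 1) * w := by
    have := mul_le_mul_of_nonneg_left hh2 (sq_nonneg ζ)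
    linear_combination this + hc2 / 2 + hX'
  have hfin' : ζ ^ 2 * (p ^ 2) ^ 2 / (4 * ((n : ℝ) + 1)) ≤ 4 * ζ * p ^ 2 * p
      + ζ ^ 2 * (A * (p ^ 2 + 1)) + 14 * ((n : ℝ) + 1) * p ^ 2 := by
    rw [hp, mul_div_assoc]
    exact (mul_le_mul_of_nonneg_left hHw (sq_nonneg ζ)).trans hfin
  have := sq_mul_le_of_quadratic hN hA hζ.le hζ1
    (by rw [hp]; linarith) hfin'
  calc F y = (ζ * p) ^ 2 := by rw [mul_pow, hp]
    _ ≤ _ := this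

end Bernstein

/-! ### Approximation by smooth functions -/

section Mollification

open MeasureTheory Filter ContinuousLinearMap
open scoped Convolution

variable {n : ℕ}

/-- The mollification of `g` by the normalized bump function of `φ`. -/
noncomputable def mollify (φ : ContDiffBump (0 : EuclideanSpace ℝ (Fin n)))
    (g : EuclideanSpace ℝ (Fin n) → ℝ) : EuclideanSpace ℝ (Fin n) → ℝ :=
  φ.normed volume ⋆[lsmul ℝ ℝ, volume] g

variable {φ : ContDiffBump (0 : EuclideanSpace ℝ (Fin n))} {g : EuclideanSpace ℝ (Fin n) → ℝ}

lemma contDiff_mollify (hg : Continuous g) {m : ℕ∞} : ContDiff ℝ m (mollify φ g) :=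
  φ.hasCompactSupport_normed.contDiff_convolution_left _ φ.contDiff_normed hg.locallyIntegrable

lemma partialDeriv_mollify (i : Fin n) (hc : HasCompactSupport g) (hg : ContDiff ℝ 1 g) :
    partialDeriv i (mollify φ g) = mollify φ (partialDeriv i g) := by
  have hφ : LocallyIntegrable (φ.normed volume) volume :=
    φ.contDiff_normed (n := 0) |>.continuous.locallyIntegrable
  funext x
  rw [partialDeriv, mollify, (hc.hasFDerivAt_convolution_right (lsmul ℝ ℝ) hφ hg x).fderiv,
    convolution_precompR_apply _ hφ (hc.fderiv ℝ) (hg.continuous_fderiv one_ne_zero)]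
  rfl

lemma mollify_sum {ι : Type*} (s : Finset ι) {G : ι → EuclideanSpace ℝ (Fin n) → ℝ}
    (hG : ∀ i ∈ s, Continuous (G i)) :
    mollify φ (fun y => ∑ i ∈ s, G i y) = fun x => ∑ i ∈ s, mollify φ (G i) x := by
  funext x
  simp only [mollify, convolution, map_sum]
  refine integral_finsetSum s fun i hi => ?_
  exact φ.hasCompactSupport_normed.convolutionExists_left (lsmul ℝ ℝ)
    (φ.contDiff_normed (n := 0)).continuous (hG i hi).locallyIntegrable x

lemma lapl_mollify (hc : HasCompactSupport g) (hg : ContDiff ℝ 2 g) :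
    lapl (mollify φ g) = mollify φ (lapl g) := by
  have c1 : ∀ i, ContDiff ℝ 1 (partialDeriv i g) := fun i => hg.partialDeriv i (by norm_num)
  change _ = mollify φ (fun y => ∑ i, partialDeriv i (partialDeriv i g) y)
  rw [mollify_sum _ fun i _ => ((c1 i).partialDeriv i (m := 0) (by norm_num)).continuous]
  funext x
  refine Finset.sum_congr rfl fun i _ => ?_
  rw [partialDeriv_mollify i hc (hg.of_le (by norm_num)),
    partialDeriv_mollify i (hc.partialDeriv i) (c1 i)]

lemma lapl_congr {v w : EuclideanSpace ℝ (Fin n) → ℝ} {x : EuclideanSpace ℝ (Fin n)}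
    (h : v =ᶠ[𝓝 x] w) : lapl v =ᶠ[𝓝 x] lapl w := by
  filter_upwards [h.eventuallyEq_nhds] with y hy
  refine Finset.sum_congr rfl fun i _ => partialDeriv_congr i ?_
  filter_upwards [hy.eventuallyEq_nhds] with z hz using partialDeriv_congr i hz

lemma lapl_mul {v w : EuclideanSpace ℝ (Fin n) → ℝ} {x : EuclideanSpace ℝ (Fin n)}
    (hv : ContDiffAt ℝ 2 v x) (hw : ContDiffAt ℝ 2 w x) :
    lapl (fun y => v y * w y) x = lapl v x * w x
      + 2 * ∑ i, partialDeriv i v x * partialDeriv i w x + v x * lapl w x := by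
  simp only [lapl, Finset.sum_mul, Finset.mul_sum, ← Finset.sum_add_distrib]
  exact Finset.sum_congr rfl fun i _ => partialDeriv_partialDeriv_mul i hv hw

lemma lapl_zero : lapl (0 : EuclideanSpace ℝ (Fin n) → ℝ) = 0 := by
  have h : ∀ i, partialDeriv i (0 : EuclideanSpace ℝ (Fin n) → ℝ) = 0 := fun i => by
    funext y; simp [partialDeriv]
  funext y
  refine Finset.sum_eq_zero fun i _ => ?_
  rw [h, h]; rfl

lemma hasCompactSupport_lapl (hc : HasCompactSupport g) : HasCompactSupport (lapl g) := by
  refine hc.mono' fun x hx => ?_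
  by_contra hx'
  have h := lapl_congr (notMem_tsupport_iff_eventuallyEq.1 hx')
  rw [lapl_zero] at h
  exact hx h.eq_of_nhds

/-- A function of class `C^2` with a Laplacian of class `C^1` in the unit ball can be modified
outside a smaller ball so that these properties become global and the support compact. The point is
that the Laplacian of a product with a smooth cutoff involves only `v`, `∇v` and `Δv`. -/
lemma exists_cutoff {v : EuclideanSpace ℝ (Fin n) → ℝ} {r : ℝ} (hr : 0 < r) (hr1 : r < 1)
    (hv : ContDiffOn ℝ 2 v (ball 0 1)) (hL : ContDiffOn ℝ 1 (lapl v) (ball 0 1)) :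
    ∃ g : EuclideanSpace ℝ (Fin n) → ℝ, HasCompactSupport g ∧ ContDiff ℝ 2 g ∧
      ContDiff ℝ 1 (lapl g) ∧ ∀ x ∈ closedBall (0 : EuclideanSpace ℝ (Fin n)) r, g =ᶠ[𝓝 x] v := by
  let χ : ContDiffBump (0 : EuclideanSpace ℝ (Fin n)) :=
    ⟨(1 + r) / 2, (3 + r) / 4, by linarith, by linarith⟩
  have hχ : ∀ m : ℕ∞, ContDiff ℝ m χ := fun m => χ.contDiff
  have hv' : ∀ x ∈ ball (0 : EuclideanSpace ℝ (Fin n)) 1, ContDiffAt ℝ 2 v x := fun x hx =>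
    hv.contDiffAt (isOpen_ball.mem_nhds hx)
  have hzero : ∀ x ∉ ball (0 : EuclideanSpace ℝ (Fin n)) 1, (fun y => χ y * v y) =ᶠ[𝓝 x] 0 := by
    intro x hx
    have hx1 : χ.rOut < ‖x‖ := by
      have : 1 ≤ ‖x‖ := by simpa using hx
      change (3 + r) / 4 < _
      linarith
    filter_upwards [continuous_norm.continuousAt.eventually (lt_mem_nhds hx1)] with y hy
    have : χ y = 0 := χ.zero_of_le_dist (by simpa using hy.le)
    simp [this]
  refine ⟨fun y => χ y * v y, χ.hasCompactSupport.mul_right, ?_, ?_, ?_⟩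
  · refine contDiff_iff_contDiffAt.2 fun x => ?_
    by_cases hx : x ∈ ball (0 : EuclideanSpace ℝ (Fin n)) 1
    · exact (hχ 2).contDiffAt.mul (hv' x hx)
    · exact contDiffAt_const.congr_of_eventuallyEq (hzero x hx)
  · refine contDiff_iff_contDiffAt.2 fun x => ?_
    by_cases hx : x ∈ ball (0 : EuclideanSpace ℝ (Fin n)) 1
    · have heq : lapl (fun y => χ y * v y) =ᶠ[𝓝 x] fun y => lapl χ y * v y
          + 2 * ∑ i, partialDeriv i χ y * partialDeriv i v y + χ y * lapl v y := by
        filter_upwards [isOpen_ball.mem_nhds hx] with y hy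
        exact lapl_mul (hχ 2).contDiffAt (hv' y hy)
      refine ContDiffAt.congr_of_eventuallyEq ?_ heq
      have c1 : ContDiff ℝ 1 (lapl χ) := ContDiff.sum fun i _ =>
        ((hχ 3).partialDeriv i (m := 2) (by norm_num)).partialDeriv i (by norm_num)
      refine ((c1.contDiffAt.mul ((hv' x hx).of_le (by norm_num))).add
        (contDiffAt_const.mul (ContDiffAt.sum fun i _ => ?_))).add
        ((hχ 1).contDiffAt.mul (hL.contDiffAt (isOpen_ball.mem_nhds hx)))
      exact ((hχ 2).partialDeriv i (m := 1) (by norm_num)).contDiffAt.mul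
        ((hv' x hx).partialDeriv i (by norm_num))
    · have h := lapl_congr (hzero x hx)
      rw [lapl_zero] at h
      exact contDiffAt_const.congr_of_eventuallyEq h
  · intro x hx
    have hx1 : ‖x‖ < χ.rIn := by
      have : ‖x‖ ≤ r := by simpa using hx
      change _ < (1 + r) / 2
      linarith
    filter_upwards [continuous_norm.continuousAt.eventually (gt_mem_nhds hx1)] with y hy
    have : χ y = 1 := χ.one_of_mem_closedBall (by simpa using hy.le)
    simp [this]

/-- Smooth approximation: mollifications `V k` for which the first and second derivatives and the
gradient of the Laplacian converge. Convergence along `atTop ×ˢ 𝓝 x`, at every point `x` of the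
closed ball of radius `r`, is locally uniform convergence to continuous limits. -/
lemma exists_smooth_approximation {v : EuclideanSpace ℝ (Fin n) → ℝ} {r : ℝ} (hr : 0 < r)
    (hr1 : r < 1) (hv : ContDiffOn ℝ 2 v (ball 0 1)) (hL : ContDiffOn ℝ 1 (lapl v) (ball 0 1)) :
    ∃ V : ℕ → EuclideanSpace ℝ (Fin n) → ℝ, (∀ k, ContDiff ℝ 3 (V k)) ∧
      ∀ x ∈ closedBall (0 : EuclideanSpace ℝ (Fin n)) r,
        (∀ i, Tendsto (fun q : ℕ × EuclideanSpace ℝ (Fin n) => partialDeriv i (V q.1) q.2)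
          (atTop ×ˢ 𝓝 x) (𝓝 (partialDeriv i v x))) ∧
        (∀ i j, Tendsto (fun q : ℕ × EuclideanSpace ℝ (Fin n) =>
          partialDeriv i (partialDeriv j (V q.1)) q.2)
          (atTop ×ˢ 𝓝 x) (𝓝 (partialDeriv i (partialDeriv j v) x))) ∧
        (∀ i, Tendsto (fun q : ℕ × EuclideanSpace ℝ (Fin n) => partialDeriv i (lapl (V q.1)) q.2)
          (atTop ×ˢ 𝓝 x) (𝓝 (partialDeriv i (lapl v) x))) := by
  obtain ⟨g, hc, hg, hgL, hgv⟩ := exists_cutoff hr hr1 hv hL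
  let φ : ℕ → ContDiffBump (0 : EuclideanSpace ℝ (Fin n)) := fun k =>
    ⟨1 / ((k : ℝ) + 1) / 2, 1 / ((k : ℝ) + 1), by positivity, half_lt_self (by positivity)⟩
  have hφ : Tendsto (fun k => (φ k).rOut) atTop (𝓝 0) := tendsto_one_div_add_atTop_nhds_zero_nat
  have conv : ∀ {G : EuclideanSpace ℝ (Fin n) → ℝ} (_ : Continuous G)
      (x : EuclideanSpace ℝ (Fin n)),
      Tendsto (fun q : ℕ × EuclideanSpace ℝ (Fin n) => mollify (φ q.1) G q.2)
        (atTop ×ˢ 𝓝 x) (𝓝 (G x)) := fun {G} hG x =>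
    ContDiffBump.convolution_tendsto_right (φ := fun q : ℕ × EuclideanSpace ℝ (Fin n) => φ q.1)
      (g := fun _ => G) (hφ.comp tendsto_fst)
      (Eventually.of_forall fun _ => hG.aestronglyMeasurable)
      ((hG.tendsto x).comp tendsto_snd) tendsto_snd
  have hg1 : ContDiff ℝ 1 g := hg.of_le (by norm_num)
  have c1 : ∀ i, ContDiff ℝ 1 (partialDeriv i g) := fun i => hg.partialDeriv i (by norm_num)
  refine ⟨fun k => mollify (φ k) g, fun k => contDiff_mollify (m := 3) hg.continuous,
    fun x hx => ⟨fun i => ?_, fun i j => ?_, fun i => ?_⟩⟩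
  · simp only [partialDeriv_mollify i hc hg1]
    rw [← partialDeriv_congr i (hgv x hx)]
    exact conv (c1 i).continuous x
  · have h : partialDeriv j g =ᶠ[𝓝 x] partialDeriv j v := by
      filter_upwards [(hgv x hx).eventuallyEq_nhds] with y hy using partialDeriv_congr j hy
    simp only [partialDeriv_mollify j hc hg1, partialDeriv_mollify i (hc.partialDeriv j) (c1 j)]
    rw [← partialDeriv_congr i h]
    exact conv ((c1 j).partialDeriv i (m := 0) (by norm_num)).continuous x
  · simp only [lapl_mollify hc hg, partialDeriv_mollify i (hasCompactSupport_lapl hc) hgL]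
    rw [← partialDeriv_congr i (lapl_congr (hgv x hx))]
    exact conv (hgL.partialDeriv i (m := 0) (by norm_num)).continuous x

end Mollification

/-! ### The estimate for solutions -/

section Solutions

open Filter

variable {n : ℕ}

/-- Bernstein's estimate under the regularity that the logarithm of a classical solution has. The
inequalities for `v` become strict when `A` is replaced by `A + 1`, so they pass to the smooth
approximations, and the conclusion, which involves only first derivatives, passes to the limit. -/
lemma bernstein_estimate_of_contDiffOn {v : EuclideanSpace ℝ (Fin n) → ℝ} {r A : ℝ} (hr : 0 < r)
    (hr1 : r < 1) (hA : 0 ≤ A) (hv : ContDiffOn ℝ 2 v (ball 0 1))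
    (hL : ContDiffOn ℝ 1 (lapl v) (ball 0 1))
    (h1 : ∀ y ∈ ball (0 : EuclideanSpace ℝ (Fin n)) 1, -A ≤ -lapl v y - gradSq v y)
    (h2 : ∀ y ∈ ball (0 : EuclideanSpace ℝ (Fin n)) 1,
      ∑ j, partialDeriv j v y * (-partialDeriv j (lapl v) y - partialDeriv j (gradSq v) y)
        ≤ A * gradSq v y)
    {x : EuclideanSpace ℝ (Fin n)} (hx : x ∈ ball (0 : EuclideanSpace ℝ (Fin n)) r) :
    (r ^ 2 - ‖x‖ ^ 2) ^ 2 * gradSq v x ≤ 368 * ((n : ℝ) + 1) ^ 2 * (2 + A) := by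
  obtain ⟨V, hV, hconv⟩ := exists_smooth_approximation hr hr1 hv hL
  have hgrad : ∀ y ∈ closedBall (0 : EuclideanSpace ℝ (Fin n)) r,
      Tendsto (fun q : ℕ × EuclideanSpace ℝ (Fin n) => gradSq (V q.1) q.2)
        (atTop ×ˢ 𝓝 y) (𝓝 (gradSq v y)) := fun y hy =>
    tendsto_finsetSum _ fun j _ => ((hconv y hy).1 j).pow 2
  have hev : ∀ y ∈ closedBall (0 : EuclideanSpace ℝ (Fin n)) r,
      ∀ᶠ q : ℕ × EuclideanSpace ℝ (Fin n) in atTop ×ˢ 𝓝 y,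
        -(A + 1) ≤ -lapl (V q.1) q.2 - gradSq (V q.1) q.2 ∧
        ∑ j, partialDeriv j (V q.1) q.2 *
            (-partialDeriv j (lapl (V q.1)) q.2 - partialDeriv j (gradSq (V q.1)) q.2)
          ≤ (A + 1) * (gradSq (V q.1) q.2 + 1) := by
    intro y hy
    have hyb : y ∈ ball (0 : EuclideanSpace ℝ (Fin n)) 1 := closedBall_subset_ball hr1 hy
    obtain ⟨t1, t2, t3⟩ := hconv y hy
    have tL : Tendsto (fun q : ℕ × EuclideanSpace ℝ (Fin n) => lapl (V q.1) q.2)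
        (atTop ×ˢ 𝓝 y) (𝓝 (lapl v y)) := tendsto_finsetSum _ fun i _ => t2 i i
    have tG : ∀ j, Tendsto (fun q : ℕ × EuclideanSpace ℝ (Fin n) =>
        partialDeriv j (gradSq (V q.1)) q.2) (atTop ×ˢ 𝓝 y) (𝓝 (partialDeriv j (gradSq v) y)) := by
      intro j
      rw [partialDeriv_gradSq j (hv.contDiffAt (isOpen_ball.mem_nhds hyb))]
      have e : ∀ q : ℕ × EuclideanSpace ℝ (Fin n), partialDeriv j (gradSq (V q.1)) q.2
          = ∑ k, 2 * partialDeriv k (V q.1) q.2 * partialDeriv j (partialDeriv k (V q.1)) q.2 :=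
        fun q => partialDeriv_gradSq j ((hV q.1).contDiffAt.of_le (by norm_num))
      simp only [e]
      exact tendsto_finsetSum _ fun k _ => ((t1 k).const_mul 2).mul (t2 j k)
    have tP := tendsto_finsetSum Finset.univ fun j _ => (t1 j).mul ((t3 j).neg.sub (tG j))
    refine Eventually.and ?_ ?_
    · have hlt : -(A + 1) < -lapl v y - gradSq v y := by linarith [h1 y hyb]
      exact ((tL.neg.sub (hgrad y hy)).eventually (lt_mem_nhds hlt)).mono fun _ h => h.le
    · have hlt : ∑ j, partialDeriv j v y *
          (-partialDeriv j (lapl v) y - partialDeriv j (gradSq v) y)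
            < (A + 1) * (gradSq v y + 1) := by
        have := h2 y hyb
        have := gradSq_nonneg v y
        nlinarith
      exact (tP.eventually_lt (((hgrad y hy).add_const 1).const_mul (A + 1)) hlt).mono
        fun _ h => h.le
  -- the tube lemma: the inequalities hold on the whole ball for all large indices
  have hunif : ∀ᶠ k in atTop, ∀ y ∈ closedBall (0 : EuclideanSpace ℝ (Fin n)) r,
        -(A + 1) ≤ -lapl (V k) y - gradSq (V k) y ∧
        ∑ j, partialDeriv j (V k) y *
            (-partialDeriv j (lapl (V k)) y - partialDeriv j (gradSq (V k)) y)
          ≤ (A + 1) * (gradSq (V k) y + 1) := by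
    simp only [← eventually_iSup,
      ← (isCompact_closedBall (0 : EuclideanSpace ℝ (Fin n)) r).prod_nhdsSet_eq_biSup] at hev
    exact hev.curry.mono fun _ h => h.self_of_nhdsSet
  have hxc := ball_subset_closedBall hx
  have hlim : Tendsto (fun k => (r ^ 2 - ‖x‖ ^ 2) ^ 2 * gradSq (V k) x) atTop
      (𝓝 ((r ^ 2 - ‖x‖ ^ 2) ^ 2 * gradSq v x)) :=
    ((hgrad x hxc).comp (tendsto_id.prodMk tendsto_const_nhds)).const_mul _
  refine le_of_tendsto hlim ?_
  filter_upwards [hunif] with k hk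
  have := bernstein_estimate hr hr1.le (by linarith : 0 ≤ A + 1) (hV k)
    (fun y hy => (hk y (ball_subset_closedBall hy)).1)
    (fun y hy => (hk y (ball_subset_closedBall hy)).2) hx
  linarith

lemma partialDeriv_log {u : EuclideanSpace ℝ (Fin n) → ℝ} {x : EuclideanSpace ℝ (Fin n)}
    (i : Fin n) (hu : DifferentiableAt ℝ u x) (hx : u x ≠ 0) :
    partialDeriv i (fun y => Real.log (u y)) x = (u x)⁻¹ * partialDeriv i u x := by
  rw [partialDeriv_comp i (Real.differentiableAt_log hx) hu, Real.deriv_log]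

lemma gradSq_log {u : EuclideanSpace ℝ (Fin n) → ℝ} {x : EuclideanSpace ℝ (Fin n)}
    (hu : DifferentiableAt ℝ u x) (hx : u x ≠ 0) :
    gradSq (fun y => Real.log (u y)) x = gradSq u x / u x ^ 2 := by
  simp only [gradSq, partialDeriv_log _ hu hx, mul_pow, ← Finset.mul_sum]
  rw [inv_pow, div_eq_inv_mul]

lemma lapl_log {u : EuclideanSpace ℝ (Fin n) → ℝ} {x : EuclideanSpace ℝ (Fin n)}
    (hu : ContDiffAt ℝ 2 u x) (hx : u x ≠ 0) :
    lapl (fun y => Real.log (u y)) x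
      = lapl u x / u x - gradSq (fun y => Real.log (u y)) x := by
  have d := hu.differentiableAt (by norm_num)
  rw [gradSq_log d hx]
  have key : ∀ i, partialDeriv i (partialDeriv i (fun y => Real.log (u y))) x
      = partialDeriv i (partialDeriv i u) x / u x - partialDeriv i u x ^ 2 / u x ^ 2 := by
    intro i
    have h : partialDeriv i (fun y => Real.log (u y)) =ᶠ[𝓝 x]
        fun y => (u y)⁻¹ * partialDeriv i u y := by
      filter_upwards [hu.eventually (by simp), hu.continuousAt.eventually_ne hx] with y h1 h2
      exact partialDeriv_log i (h1.differentiableAt (by norm_num)) h2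
    have di : DifferentiableAt ℝ (partialDeriv i u) x :=
      (hu.partialDeriv i (m := 1) (by norm_num)).differentiableAt (by norm_num)
    rw [partialDeriv_congr i h, partialDeriv_mul i (d.fun_inv hx) di,
      partialDeriv_comp (g := fun s => s⁻¹) i (differentiableAt_inv hx) d, deriv_inv]
    field_simp
    ring
  rw [lapl, lapl, gradSq, Finset.sum_div, Finset.sum_div, ← Finset.sum_sub_distrib]
  exact Finset.sum_congr rfl fun i _ => key i

/-- The logarithmic gradient estimate with explicit constant. With `v = log u` and
`h = f(u) / u` one has `-Δv = |∇v|² + h` and `∇v · ∇h = (f'(u) - f(u) / u) |∇v|²`, so that the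
two bounds assumed here are those of Bernstein's estimate. -/
lemma IsPositiveClassicalSolution.gradient_estimate {f : ℝ → ℝ}
    {u : EuclideanSpace ℝ (Fin n) → ℝ} (hu : IsPositiveClassicalSolution f u)
    (hf : ContDiffOn ℝ 1 f (Ioi 0)) {r A : ℝ} (hr : 0 < r) (hr1 : r < 1) (hA : 0 ≤ A)
    (h1 : ∀ y ∈ ball (0 : EuclideanSpace ℝ (Fin n)) 1, -A ≤ f (u y) / u y)
    (h2 : ∀ y ∈ ball (0 : EuclideanSpace ℝ (Fin n)) 1, deriv f (u y) - f (u y) / u y ≤ A)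
    {x : EuclideanSpace ℝ (Fin n)} (hx : x ∈ ball (0 : EuclideanSpace ℝ (Fin n)) r) :
    (r ^ 2 - ‖x‖ ^ 2) ^ 2 * (‖∇ u x‖ / u x) ^ 2 ≤ 368 * ((n : ℝ) + 1) ^ 2 * (2 + A) := by
  have hpos : ∀ y ∈ ball (0 : EuclideanSpace ℝ (Fin n)) 1, 0 < u y := fun y hy =>
    hu.pos y (ball_subset_closedBall hy)
  have cu : ∀ y ∈ ball (0 : EuclideanSpace ℝ (Fin n)) 1, ContDiffAt ℝ 2 u y := fun y hy =>
    hu.contDiffOn.contDiffAt (isOpen_ball.mem_nhds hy)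
  have du : ∀ y ∈ ball (0 : EuclideanSpace ℝ (Fin n)) 1, DifferentiableAt ℝ u y := fun y hy =>
    (cu y hy).differentiableAt (by norm_num)
  have cf : ∀ y ∈ ball (0 : EuclideanSpace ℝ (Fin n)) 1, ContDiffAt ℝ 1 f (u y) := fun y hy =>
    hf.contDiffAt (isOpen_Ioi.mem_nhds (hpos y hy))
  set v : EuclideanSpace ℝ (Fin n) → ℝ := fun y => Real.log (u y) with hv
  have cv : ContDiffOn ℝ 2 v (ball 0 1) := hu.contDiffOn.log fun y hy => (hpos y hy).ne'
  have cv' : ∀ y ∈ ball (0 : EuclideanSpace ℝ (Fin n)) 1, ContDiffAt ℝ 2 v y := fun y hy =>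
    cv.contDiffAt (isOpen_ball.mem_nhds hy)
  have cq : ∀ y ∈ ball (0 : EuclideanSpace ℝ (Fin n)) 1,
      ContDiffAt ℝ 1 (fun s => f s / s) (u y) := fun y hy =>
    (cf y hy).fun_div contDiffAt_fun_id (hpos y hy).ne'
  have hLv : ∀ y ∈ ball (0 : EuclideanSpace ℝ (Fin n)) 1,
      lapl v y = -gradSq v y - f (u y) / u y := by
    intro y hy
    have e := hu.equation y hy
    rw [laplacian_eq_sum_partialDeriv (cu y hy)] at e
    rw [hv, lapl_log (cu y hy) (hpos y hy).ne', ← e, lapl]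
    ring
  have cL : ContDiffOn ℝ 1 (lapl v) (ball 0 1) := by
    have h : ContDiffOn ℝ 1 (fun y => -gradSq v y - f (u y) / u y) (ball 0 1) := fun y hy =>
      (((cv' y hy).gradSq (by norm_num)).neg.sub ((cq y hy).comp y
        ((cu y hy).of_le (by norm_num)))).contDiffWithinAt
    exact h.congr hLv
  have hgradL : ∀ y ∈ ball (0 : EuclideanSpace ℝ (Fin n)) 1, ∀ j,
      -partialDeriv j (lapl v) y - partialDeriv j (gradSq v) y
        = (deriv f (u y) - f (u y) / u y) * partialDeriv j v y := by
    intro y hy j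
    have heq : lapl v =ᶠ[𝓝 y] fun z => -gradSq v z - f (u z) / u z := by
      filter_upwards [isOpen_ball.mem_nhds hy] with z hz using hLv z hz
    have dG : DifferentiableAt ℝ (gradSq v) y :=
      ((cv' y hy).gradSq (m := 1) (by norm_num)).differentiableAt (by norm_num)
    have dq := (cq y hy).differentiableAt (by norm_num)
    have dq' : DifferentiableAt ℝ (fun z => f (u z) / u z) y := dq.comp y (du y hy)
    have hne := (hpos y hy).ne'
    rw [partialDeriv_congr j heq, partialDeriv_sub j dG.fun_neg dq', partialDeriv_neg,
      partialDeriv_comp (g := fun s => f s / s) j dq (du y hy),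
      deriv_fun_div ((cf y hy).differentiableAt (by norm_num)) differentiableAt_fun_id hne,
      deriv_id'', hv, partialDeriv_log j (du y hy) hne]
    field_simp
    ring
  have hmain := bernstein_estimate_of_contDiffOn hr hr1 hA cv cL
    (fun y hy => by rw [hLv y hy]; linarith [h1 y hy])
    (fun y hy => by
      have : ∑ j, partialDeriv j v y * (-partialDeriv j (lapl v) y - partialDeriv j (gradSq v) y)
          = (deriv f (u y) - f (u y) / u y) * gradSq v y := by
        rw [gradSq, Finset.mul_sum]
        exact Finset.sum_congr rfl fun j _ => by rw [hgradL y hy j]; ring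
      rw [this]
      exact mul_le_mul_of_nonneg_right (h2 y hy) (gradSq_nonneg v y)) hx
  have hx1 := ball_subset_ball hr1.le hx
  have : gradSq v x = (‖∇ u x‖ / u x) ^ 2 := by
    rw [hv, gradSq_log (du x hx1) (hpos x hx1).ne', div_pow, norm_gradient_sq, gradSq]
  rwa [this] at hmain

/-- The logarithmic gradient estimate in terms of suprema; no Hölder continuity of `f'` is
needed. -/
lemma exists_supBall_gradient_le (n : ℕ) {σ : ℝ} (hσ : σ ∈ Ioo (0 : ℝ) 1) :
    ∃ C : ℝ≥0, 0 < C ∧ ∀ f : ℝ → ℝ, ContDiffOn ℝ 1 f (Ioi 0) →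
      ∀ u : EuclideanSpace ℝ (Fin n) → ℝ, IsPositiveClassicalSolution f u →
        supBall σ (fun x => ‖∇ u x‖ / u x) ≤
          C * (1 + supBall 1 (fun x => √((deriv f (u x))⁺ + (f (u x))⁻ / u x))) := by
  obtain ⟨hσ0, hσ1⟩ := hσ
  set r : ℝ := (1 + σ) / 2 with hr
  have hσr : σ < r := by rw [hr]; linarith
  have hr1 : r < 1 := by rw [hr]; linarith
  set d : ℝ := r ^ 2 - σ ^ 2 with hd
  have hd0 : 0 < d := by rw [hd]; nlinarith
  have hC0 : 0 < 40 * ((n : ℝ) + 1) / d := by positivity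
  refine ⟨Real.toNNReal (40 * ((n : ℝ) + 1) / d), Real.toNNReal_pos.2 hC0, fun f hf u hu => ?_⟩
  set S : ℝ≥0∞ := supBall 1 (fun x => √((deriv f (u x))⁺ + (f (u x))⁻ / u x)) with hS
  rcases eq_or_ne S ⊤ with htop | htop
  · rw [htop, add_top, ENNReal.mul_top]
    · exact le_top
    · exact ENNReal.coe_ne_zero.2 (Real.toNNReal_pos.2 hC0).ne'
  set M : ℝ := S.toReal with hM
  have hM0 : 0 ≤ M := ENNReal.toReal_nonneg
  have hbound : ∀ y ∈ ball (0 : EuclideanSpace ℝ (Fin n)) 1,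
      (deriv f (u y))⁺ + (f (u y))⁻ / u y ≤ M ^ 2 := by
    intro y hy
    have h : ENNReal.ofReal (√((deriv f (u y))⁺ + (f (u y))⁻ / u y)) ≤ S := by
      rw [hS, supBall]
      exact le_iSup₂ (f := fun x (_ : x ∈ ball (0 : EuclideanSpace ℝ (Fin n)) 1) =>
        ENNReal.ofReal (√((deriv f (u x))⁺ + (f (u x))⁻ / u x))) y hy
    have h' := (ENNReal.ofReal_le_iff_le_toReal htop).1 h
    exact (Real.sqrt_le_left hM0).1 h'
  have hpos : ∀ y ∈ ball (0 : EuclideanSpace ℝ (Fin n)) 1, 0 < u y := fun y hy =>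
    hu.pos y (ball_subset_closedBall hy)
  have hneg : ∀ y ∈ ball (0 : EuclideanSpace ℝ (Fin n)) 1,
      -(f (u y) / u y) ≤ (f (u y))⁻ / u y := fun y hy => by
    rw [← neg_div]
    exact div_le_div_of_nonneg_right (neg_le_negPart _) (hpos y hy).le
  have h1 : ∀ y ∈ ball (0 : EuclideanSpace ℝ (Fin n)) 1, -M ^ 2 ≤ f (u y) / u y := fun y hy => by
    linarith [hbound y hy, hneg y hy, posPart_nonneg (deriv f (u y))]
  have h2 : ∀ y ∈ ball (0 : EuclideanSpace ℝ (Fin n)) 1,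
      deriv f (u y) - f (u y) / u y ≤ M ^ 2 := fun y hy => by
    linarith [hbound y hy, hneg y hy, le_posPart (deriv f (u y))]
  refine iSup₂_le fun x hx => ?_
  have hxσ : ‖x‖ < σ := by simpa using hx
  have hxr : x ∈ ball (0 : EuclideanSpace ℝ (Fin n)) r := ball_subset_ball hσr.le hx
  have hmain := hu.gradient_estimate hf (hσ0.trans hσr) hr1 (sq_nonneg M) h1 h2 hxr
  set g : ℝ := ‖∇ u x‖ / u x
  have hdx : d ≤ r ^ 2 - ‖x‖ ^ 2 := by
    rw [hd]; nlinarith [norm_nonneg x]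
  have hreal : g ≤ 40 * ((n : ℝ) + 1) / d * (1 + M) := by
    rw [div_mul_eq_mul_div, le_div_iff₀ hd0, mul_comm]
    refine abs_le_of_sq_le_sq' ?_ (by positivity) |>.2
    calc (d * g) ^ 2 = d ^ 2 * g ^ 2 := by ring
      _ ≤ (r ^ 2 - ‖x‖ ^ 2) ^ 2 * g ^ 2 := by gcongr
      _ ≤ 368 * ((n : ℝ) + 1) ^ 2 * (2 + M ^ 2) := hmain
      _ ≤ (40 * ((n : ℝ) + 1) * (1 + M)) ^ 2 := by
        have : 0 ≤ ((n : ℝ) + 1) ^ 2 * (864 + 3200 * M + 1232 * M ^ 2) := by positivity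
        linarith
  calc ENNReal.ofReal g ≤ ENNReal.ofReal (40 * ((n : ℝ) + 1) / d * (1 + M)) :=
        ENNReal.ofReal_le_ofReal hreal
    _ = _ := by
      rw [ENNReal.ofReal_mul hC0.le, ENNReal.ofReal_add zero_le_one hM0, ENNReal.ofReal_one,
        hM, ENNReal.ofReal_toReal htop, ENNReal.ofReal]

end Solutions

theorem theorem2p1 (n : ℕ) (σ : ℝ) (hσ : σ ∈ Ioo (0 : ℝ) 1) :
    (∃ C₁ : ℝ≥0, 0 < C₁ ∧
      ∀ f : ℝ → ℝ, ContDiffOn ℝ 1 f (Ioi 0) → LocallyHolderOn (deriv f) (Ioi 0) →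
      ∀ u : EuclideanSpace ℝ (Fin n) → ℝ, IsPositiveClassicalSolution f u →
        supBall σ (fun x => ‖∇ u x‖ / u x) ≤
          C₁ * (1 + supBall 1 (fun x => √((deriv f (u x))⁺ + (f (u x))⁻ / u x)))) ∧
    (∀ p : ℝ, 1 < p → ∃ C₂ : ℝ≥0, 0 < C₂ ∧
      ∀ u : EuclideanSpace ℝ (Fin n) → ℝ, IsPositiveClassicalSolution (fun s => s ^ p) u →
        supBall σ (fun x => ‖∇ u x‖ / u x) ≤
          C₂ * (1 + supBall 1 u) ^ ((p - 1) / 2)) := by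
  obtain ⟨C, hC, h⟩ := exists_supBall_gradient_le n hσ
  refine ⟨⟨C, hC, fun f hf _ u hu => h f hf u hu⟩, fun p hp => ?_⟩
  have hp0 : 0 < (p - 1) / 2 := by linarith
  refine ⟨C * (1 + NNReal.sqrt p.toNNReal), by positivity, fun u hu => ?_⟩
  have hf : ContDiffOn ℝ 1 (fun s : ℝ => s ^ p) (Ioi 0) := fun s hs =>
    (Real.contDiffAt_rpow_const_of_ne (ne_of_gt hs)).contDiffWithinAt
  refine (h _ hf u hu).trans ?_
  set T : ℝ≥0∞ := (1 + supBall 1 u) ^ ((p - 1) / 2)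
  have h1T : 1 ≤ T := ENNReal.one_le_rpow le_self_add hp0
  have hsup : supBall 1 (fun x => √((deriv (fun s : ℝ => s ^ p) (u x))⁺ + (u x ^ p)⁻ / u x))
      ≤ NNReal.sqrt p.toNNReal * T := by
    refine iSup₂_le fun x hx => ?_
    have hux : 0 < u x := hu.pos x (ball_subset_closedBall hx)
    have hroot : √((deriv (fun s : ℝ => s ^ p) (u x))⁺ + (u x ^ p)⁻ / u x)
        = √p * u x ^ ((p - 1) / 2) := by
      rw [negPart_eq_zero.2 (Real.rpow_nonneg hux.le p), Real.deriv_rpow_const,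
        posPart_eq_self.2 (by positivity), zero_div, add_zero, Real.sqrt_mul (by linarith),
        Real.sqrt_eq_rpow (u x ^ (p - 1)), ← Real.rpow_mul hux.le]
      congr 2; ring
    have hle : ENNReal.ofReal (u x) ≤ 1 + supBall 1 u :=
      (le_iSup₂ (f := fun x (_ : x ∈ ball (0 : EuclideanSpace ℝ (Fin n)) 1) =>
        ENNReal.ofReal (u x)) x hx).trans le_add_self
    change ENNReal.ofReal (√((deriv (fun s : ℝ => s ^ p) (u x))⁺ + (u x ^ p)⁻ / u x)) ≤ _
    rw [hroot, ENNReal.ofReal_mul (Real.sqrt_nonneg p), ← ENNReal.ofReal_rpow_of_pos hux]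
    refine mul_le_mul' (le_of_eq ?_) (ENNReal.rpow_le_rpow hle hp0.le)
    rw [ENNReal.ofReal, Real.sqrt, Real.toNNReal_coe]
  calc (C : ℝ≥0∞) * (1 + supBall 1
        (fun x => √((deriv (fun s : ℝ => s ^ p) (u x))⁺ + (u x ^ p)⁻ / u x)))
      ≤ C * (T + NNReal.sqrt p.toNNReal * T) := by gcongr
    _ = ↑(C * (1 + NNReal.sqrt p.toNNReal)) * T := by push_cast; ring
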